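/- Let $G=(V,E)$ be a finite simple connected graph. A vertex of a connected graph is a cut-vertex if its deletion disconnects the graph; a block of $G$ is a maximal connected subgraph of $G$ that has no cut-vertex of its own. Assume that $G$ is a multi-block graph, i.e. every block $G_t$ ($1\le t\le b$) of $G$ is a complete $m$-partite graph for some $m\ge 2$ (depending on $t$). For a connected graph $H$ let $D(H)$ be its distance matrix, whose $(u,v)$ entry is the length of a shortest path in $H$ from $u$ to $v$, and for a square matrix $B$ let $\operatorname{cof} B$ be the sum of all its cofactors. For a finite sequence $n_1,\dots,n_m$ of positive integers put $$\gamma_{n_1,\dots,n_m}=\sum_{i=1}^m n_i\prod_{j\ne i}(n_j-2),\qquad \beta_{n_1,\dots,n_m}=\gamma_{n_1,\dots,n_m}+\prod_{i=1}^m (n_i-2),$$ and let $\gamma_{\widehat{n_i}}$, $\beta_{\widehat{n_i}}$ be the same quantities for the sequence with $n_i$ omitted. For a complete $m$-partite graph $K=K_{n_1,\dots,n_m}$ with partite sets $V_1,\dots,V_m$, $|V_i|=n_i\ge 1$, $m\ge 2$, and with $\gamma=\gamma_{n_1,\dots,n_m}\neq 0$, define the vector $\mu_K$ and the Laplacian-like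 matrix $\mathcal L(K)$ by $$\mu_K(v)=\frac1\gamma\prod_{j\ne i}(n_j-2)\quad (v\in V_i),$$ $$\mathcal L(K)_{uv}=\begin{cases}\dfrac{(n_i-1)\beta_{\widehat{n_i}}-2\gamma_{\widehat{n_i}}}{2\gamma} & u=v\in V_i,\\[2mm] -\dfrac{\beta_{\widehat{n_i}}}{2\gamma} & u\ne v,\ u,v\in V_i,\\[2mm] \dfrac{1}{\gamma}\prod_{l\ne i,j}(n_l-2) & u\in V_i,\ v\in V_j,\ i\neq j.\end{cases}$$ Suppose that $\operatorname{cof} D(G_t)\neq 0$ for every block $G_t$ and that $\det D(G)\ne 0$. Then the number $\gamma$ of every block is nonzero, so that the following quantities are defined: $\lambda_G=\sum_{t=1}^b \det D(G_t)/\operatorname{cof} D(G_t)$; the vector $\mu\in\mathbb R^V$ with $$\mu(v)=\sum_{t:\,v\in G_t}\mu_{G_t}(v)-(k-1)$$ for a vertex $v$ that lies in exactly $k$ blocks; and the $V\times V$ matrix $\mathcal L=\sum_{t=1}^b\mathcal L(G_t)$, where each $\mathcal L(G_t)$ is extended by zero to $V\times V$. Moreover $\lambda_G\ne 0$ and $$D(G)^{-1}=-\mathcal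 L+\frac1{\lambda_G}\,\mu\mu^{t}.$$ -/

import Mathlib

open scoped Classical

namespace MultiBlock

section Matrices

variable {W : Type*} [Fintype W] [DecidableEq W]

/-- The sum of all cofactors of a square matrix (the sum of all entries of the adjugate). -/
noncomputable def cof (B : Matrix W W ℝ) : ℝ := ∑ i, ∑ j, B.adjugate i j

/-- The distance matrix of a (connected) graph. -/
noncomputable def distMatrix (K : SimpleGraph W) : Matrix W W ℝ :=
  Matrix.of fun u v => (K.dist u v : ℝ)

end Matrices

section Blocks

/-- A vertex `v` of a connected graph is a cut-vertex if deleting it disconnects the graph.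
(The graph without vertices is not disconnected.) -/
def IsCutVertex {W : Type*} (K : SimpleGraph W) (v : W) : Prop :=
  ¬ (K.induce {v}ᶜ).Preconnected

variable {V : Type*}

/-- A block is a maximal connected subgraph that has no cut-vertex (of its own). -/
def IsBlock {G : SimpleGraph V} (H : G.Subgraph) : Prop :=
  Maximal (fun H : G.Subgraph => H.coe.Connected ∧ ∀ v, ¬ IsCutVertex H.coe v) H

/-- The finite set of all blocks of a finite graph. -/
noncomputable def blocks [Fintype V] (G : SimpleGraph V) : Finset G.Subgraph :=
  (Set.toFinite {H : G.Subgraph | IsBlock H}).toFinset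

end Blocks

section CompleteMultipartite

variable {W : Type*} [Fintype W] [DecidableEq W]

/-- The set of all vertices that are not adjacent to `v` (`v` included). In a complete multipartite
graph this is the partite set that contains `v`. -/
noncomputable def part (K : SimpleGraph W) (v : W) : Finset W :=
  Finset.univ.filter fun u => ¬ K.Adj v u

/-- The partite sets of a complete multipartite graph. -/
noncomputable def parts (K : SimpleGraph W) : Finset (Finset W) :=
  Finset.univ.image (part K)

/-- `K` is a complete `m`-partite graph for some `m ≥ 2`: its vertex set has a partition into `m`
nonempty sets such that two vertices are adjacent iff they lie in different sets. -/
def IsCompletePartite (K : SimpleGraph W) : Prop :=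
  ∃ P : Finpartition (Finset.univ : Finset W), 2 ≤ P.parts.card ∧
    ∀ u v, K.Adj u v ↔ P.part u ≠ P.part v

/-- The partition of a complete multipartite graph is the one given by `part` and `parts`. -/
theorem parts_eq (K : SimpleGraph W) (P : Finpartition (Finset.univ : Finset W))
    (h : ∀ u v, K.Adj u v ↔ P.part u ≠ P.part v) :
    (∀ v, part K v = P.part v) ∧ parts K = P.parts := by
  have h1 : ∀ v, part K v = P.part v := by
    intro v
    ext u
    simp only [part, Finset.mem_filter, Finset.mem_univ, true_and, h, not_not]
    rw [P.mem_part_iff_part_eq_part (Finset.mem_univ u) (Finset.mem_univ v)]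
    exact eq_comm
  refine ⟨h1, ?_⟩
  ext s
  simp only [parts, Finset.mem_image, Finset.mem_univ, true_and, h1]
  constructor
  · rintro ⟨v, rfl⟩
    exact P.part_mem.2 (Finset.mem_univ v)
  · intro hs
    obtain ⟨v, hv⟩ := P.nonempty_of_mem_parts hs
    exact ⟨v, P.part_eq_of_mem hs hv⟩

/-- `γ = ∑ᵢ nᵢ ∏_{j ≠ i} (nⱼ - 2)` for a family `S` of sets with sizes `nᵢ`. -/
noncomputable def gammaOf (S : Finset (Finset W)) : ℝ :=
  ∑ P ∈ S, (P.card : ℝ) * ∏ Q ∈ S.erase P, ((Q.card : ℝ) - 2)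

/-- `β = ∑ᵢ nᵢ ∏_{j ≠ i} (nⱼ - 2) + ∏ᵢ (nᵢ - 2)` for a family `S` of sets with sizes `nᵢ`. -/
noncomputable def betaOf (S : Finset (Finset W)) : ℝ :=
  gammaOf S + ∏ P ∈ S, ((P.card : ℝ) - 2)

/-- The vector `μ_K` of a complete multipartite graph `K`. -/
noncomputable def muSingle (K : SimpleGraph W) (v : W) : ℝ :=
  (1 / gammaOf (parts K)) * ∏ P ∈ (parts K).erase (part K v), ((P.card : ℝ) - 2)

/-- The Laplacian-like matrix of a complete multipartite graph `K`. -/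
noncomputable def lapSingle (K : SimpleGraph W) : Matrix W W ℝ :=
  Matrix.of fun u v =>
    if u = v then
      ((((part K u).card : ℝ) - 1) * betaOf ((parts K).erase (part K u))
          - 2 * gammaOf ((parts K).erase (part K u))) / (2 * gammaOf (parts K))
    else if K.Adj u v then
      (∏ P ∈ ((parts K).erase (part K u)).erase (part K v), ((P.card : ℝ) - 2))
        / gammaOf (parts K)
    else
      - betaOf ((parts K).erase (part K u)) / (2 * gammaOf (parts K))

end CompleteMultipartite

section MultiBlockGraphs

variable {V : Type*} [Fintype V] [DecidableEq V]

/-- A connected graph all of whose blocks are complete `m`-partite graphs with `m ≥ 2`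
(the number `m` may vary with the block). -/
def IsMultiBlock (G : SimpleGraph V) : Prop :=
  G.Connected ∧ ∀ H ∈ blocks G, IsCompletePartite H.coe

/-- `λ_G = ∑ₜ det D(Gₜ) / cof D(Gₜ)`, summed over the blocks `Gₜ` of `G`. -/
noncomputable def lambdaG (G : SimpleGraph V) : ℝ :=
  ∑ H ∈ blocks G, (distMatrix H.coe).det / cof (distMatrix H.coe)

/-- `μ_G(v) = ∑ₜ μ_{Gₜ}(v) - (k - 1)`, where `k` is the number of blocks that contain `v` and
the sum runs over these blocks. -/
noncomputable def muG (G : SimpleGraph V) (v : V) : ℝ :=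
  (∑ H ∈ blocks G, if h : v ∈ H.verts then muSingle H.coe ⟨v, h⟩ else 0)
    - ((((blocks G).filter fun H => v ∈ H.verts).card : ℝ) - 1)

/-- The Laplacian-like matrix of a block, extended by zero to all vertices of the graph. -/
noncomputable def lapBlock {G : SimpleGraph V} (H : G.Subgraph) : Matrix V V ℝ :=
  Matrix.of fun u v =>
    if h : u ∈ H.verts ∧ v ∈ H.verts then lapSingle H.coe ⟨u, h.1⟩ ⟨v, h.2⟩ else 0

/-- The Laplacian-like matrix of a multi-block graph. -/
noncomputable def lapG (G : SimpleGraph V) : Matrix V V ℝ :=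
  ∑ H ∈ blocks G, lapBlock H

end MultiBlockGraphs

end MultiBlock

/-! Write D for the distance matrix and 1 for the all-ones vector. Everything rests on three
identities: Dμ = λ1, ∑μ = 1 and D𝓛 = 1μᵗ - I. They give D(-𝓛 + μμᵗ/λ) = I. If λ were 0, the nonzero
vector μ would lie in the kernel of D.

For one block the identities are computed directly: D is the all-ones matrix, plus the all-ones
matrix on each partite set, minus 2I.

They are glued through gates. Every walk from u into a block H passes through one vertex g of H, and
H is isometric, so D(u,v) = D(u,g) + D_H(g,v) on H. The columns of 𝓛(H) sum to 0, so D(u,g) drops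
out and H contributes μ_H(w) - [g = w] to (D𝓛)(u,w). Among the k blocks containing w, the gate of u
is w in all of them if u = w, and otherwise in all but the block of the last edge of a shortest path
from u to w. This count, k - 1 + [u = w], explains the correction k - 1 in μ (`IsGateMap.sum_eq`,
`IsGateMap.muG_eq`). -/

namespace MultiBlock

/-! ### One complete multipartite graph -/

section CompleteMultipartite

variable {W : Type*} [Fintype W] [DecidableEq W] {K : SimpleGraph W}

theorem IsCompletePartite.adj_iff (h : IsCompletePartite K) (u v : W) :
    K.Adj u v ↔ part K u ≠ part K v := by
  obtain ⟨P, -, hP⟩ := h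
  rw [(parts_eq K P hP).1, (parts_eq K P hP).1, hP]

theorem IsCompletePartite.mem_part_iff (h : IsCompletePartite K) {u v : W} :
    u ∈ part K v ↔ part K u = part K v := by
  rw [part, Finset.mem_filter, h.adj_iff, not_not]
  exact ⟨fun h => h.2.symm, fun h => ⟨Finset.mem_univ u, h.symm⟩⟩

theorem part_mem_parts (K : SimpleGraph W) (v : W) : part K v ∈ parts K :=
  Finset.mem_image_of_mem _ (Finset.mem_univ v)

theorem IsCompletePartite.exists_adj (h : IsCompletePartite K) (u : W) : ∃ z, K.Adj u z := by
  obtain ⟨P, h2, hP⟩ := h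
  obtain ⟨Q, hQ, hne⟩ := Finset.exists_mem_ne h2 (P.part u)
  obtain ⟨z, hz⟩ := P.nonempty_of_mem_parts hQ
  refine ⟨z, (hP u z).2 ?_⟩
  rw [P.part_eq_of_mem hQ hz]
  exact hne.symm

theorem IsCompletePartite.distMatrix_apply (h : IsCompletePartite K) (u v : W) :
    distMatrix K u v =
      1 + (if part K v = part K u then 1 else 0) - 2 * (if u = v then (1 : ℝ) else 0) := by
  simp only [distMatrix, Matrix.of_apply]
  by_cases huv : u = v
  · subst huv
    simp
    norm_num
  by_cases ha : K.Adj u v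
  · rw [SimpleGraph.dist_eq_one_iff_adj.2 ha]
    have := (h.adj_iff u v).1 ha
    simp [huv, this.symm]
  · obtain ⟨z, hz⟩ := h.exists_adj u
    have hp : part K u = part K v := by
      by_contra hne
      exact ha ((h.adj_iff u v).2 hne)
    have hzv : K.Adj z v := by
      rw [h.adj_iff] at hz ⊢
      rw [← hp]
      exact hz.symm
    have hle : K.dist u v ≤ 2 :=
      SimpleGraph.dist_le (SimpleGraph.Walk.cons hz (SimpleGraph.Walk.cons hzv .nil))
    have h0 : K.dist u v ≠ 0 := fun h0 => huv
      (((SimpleGraph.Walk.cons hz (.cons hzv .nil)).reachable).dist_eq_zero_iff.1 h0)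
    have h1 : K.dist u v ≠ 1 := fun h1 => ha (SimpleGraph.dist_eq_one_iff_adj.1 h1)
    have : K.dist u v = 2 := by omega
    rw [this]
    simp [huv, hp]
    norm_num

theorem IsCompletePartite.sum_eq_sum_parts (h : IsCompletePartite K) (f : W → ℝ) :
    ∑ v, f v = ∑ Q ∈ parts K, ∑ v ∈ Q, f v := by
  rw [← Finset.sum_fiberwise_of_maps_to (fun v _ => part_mem_parts K v)]
  refine Finset.sum_congr rfl fun Q hQ => Finset.sum_congr ?_ fun _ _ => rfl
  obtain ⟨w, -, rfl⟩ := Finset.mem_image.1 hQ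
  ext v
  simp [h.mem_part_iff]

theorem IsCompletePartite.part_eq_of_mem_parts (h : IsCompletePartite K) {Q : Finset W}
    (hQ : Q ∈ parts K) {v : W} (hv : v ∈ Q) : part K v = Q := by
  obtain ⟨w, -, rfl⟩ := Finset.mem_image.1 hQ
  exact h.mem_part_iff.1 hv

theorem IsCompletePartite.sum_comp_part (h : IsCompletePartite K) (f : Finset W → ℝ) :
    ∑ v, f (part K v) = ∑ Q ∈ parts K, (Q.card : ℝ) * f Q := by
  rw [h.sum_eq_sum_parts]
  refine Finset.sum_congr rfl fun Q hQ => ?_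
  rw [Finset.sum_congr rfl fun v hv => by rw [h.part_eq_of_mem_parts hQ hv]]
  simp

/-- Rows of the distance matrix act by summing everything, adding the sum over the own partite
set, and subtracting twice the own value. -/
theorem IsCompletePartite.sum_distMatrix_mul (h : IsCompletePartite K) (u : W) (f : W → ℝ) :
    ∑ v, distMatrix K u v * f v = ∑ v, f v + ∑ v ∈ part K u, f v - 2 * f u := by
  have : ∀ v, distMatrix K u v * f v = f v + (if v ∈ part K u then f v else 0)
      - 2 * (if u = v then f v else 0) := by
    intro v
    rw [h.distMatrix_apply]
    simp only [h.mem_part_iff]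
    split_ifs <;> ring
  simp_rw [this, Finset.sum_sub_distrib, Finset.sum_add_distrib, ← Finset.mul_sum]
  simp

omit [Fintype W] in
theorem gammaOf_eq_of_mem {S : Finset (Finset W)} {P : Finset W} (hP : P ∈ S) :
    gammaOf S = P.card * ∏ Q ∈ S.erase P, ((Q.card : ℝ) - 2)
      + ((P.card : ℝ) - 2) * gammaOf (S.erase P) := by
  unfold gammaOf
  rw [← Finset.add_sum_erase S _ hP, Finset.mul_sum]
  congr 1
  refine Finset.sum_congr rfl fun Q hQ => ?_
  have hQP : P ∈ S.erase Q := Finset.mem_erase.2 ⟨(Finset.ne_of_mem_erase hQ).symm, hP⟩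
  rw [← Finset.mul_prod_erase _ _ hQP, Finset.erase_right_comm]
  ring

/-- The vector `γ μ_K`. -/
noncomputable def numVec (K : SimpleGraph W) (v : W) : ℝ :=
  ∏ P ∈ (parts K).erase (part K v), ((P.card : ℝ) - 2)

theorem muSingle_eq (K : SimpleGraph W) (v : W) :
    muSingle K v = 1 / gammaOf (parts K) * numVec K v := rfl

theorem IsCompletePartite.sum_numVec (h : IsCompletePartite K) :
    ∑ v, numVec K v = gammaOf (parts K) :=
  h.sum_comp_part fun Q => ∏ P ∈ (parts K).erase Q, ((P.card : ℝ) - 2)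

/-- `numVec` is constant on each partite set, so row u gives γ + (nᵢ - 2)∏_{j≠i}(nⱼ - 2) = β,
whatever the set of u. -/
theorem IsCompletePartite.sum_distMatrix_mul_numVec (h : IsCompletePartite K) (u : W) :
    ∑ v, distMatrix K u v * numVec K v = betaOf (parts K) := by
  rw [h.sum_distMatrix_mul, h.sum_numVec, betaOf,
    ← Finset.mul_prod_erase _ _ (part_mem_parts K u)]
  have : ∑ v ∈ part K u, numVec K v = (part K u).card * numVec K u := by
    rw [Finset.sum_congr rfl (g := fun _ => numVec K u), Finset.sum_const, nsmul_eq_mul]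
    intro v hv
    simp only [numVec, h.mem_part_iff.1 hv]
  rw [this, numVec]
  ring

/-- Multiply Bx = c1 by the adjugate and add up the entries. With x = `numVec` this reads γ det D =
β cof D. -/
theorem sum_adjugate_mul_eq {B : Matrix W W ℝ} {x : W → ℝ} {c : ℝ}
    (hx : ∀ u, ∑ v, B u v * x v = c) : B.det * ∑ v, x v = c * cof B := by
  have h1 : B.mulVec x = fun _ => c := funext hx
  have h2 : B.det • x = B.adjugate.mulVec (fun _ => c) := by
    rw [← h1, Matrix.mulVec_mulVec, Matrix.adjugate_mul, Matrix.smul_mulVec, Matrix.one_mulVec]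
  have h3 := congrArg (fun y : W → ℝ => ∑ v, y v) h2
  simp only [Pi.smul_apply, smul_eq_mul, ← Finset.mul_sum, Matrix.mulVec, dotProduct,
    ← Finset.sum_mul] at h3
  rw [h3, cof, mul_comm]

/-- Column j of the adjugate sums to the determinant of B with row j replaced by ones, and x is in
the kernel of that matrix too. -/
theorem cof_eq_zero_of_kernel {B : Matrix W W ℝ} {x : W → ℝ} (hx0 : x ≠ 0)
    (hx : ∀ u, ∑ v, B u v * x v = 0) (hs : ∑ v, x v = 0) : cof B = 0 := by
  refine Finset.sum_comm.trans (Finset.sum_eq_zero fun j _ => ?_)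
  have h1 : ∑ i, B.adjugate i j = (B.updateRow j 1).det := by
    rw [← Matrix.cramer_transpose_apply, Matrix.cramer_eq_adjugate_mulVec,
      ← Matrix.adjugate_transpose]
    simp [Matrix.mulVec, dotProduct]
  rw [h1]
  refine Matrix.exists_mulVec_eq_zero_iff.1 ⟨x, hx0, ?_⟩
  ext u
  by_cases hu : u = j
  · subst hu
    simpa [Matrix.mulVec, dotProduct] using hs
  · simpa [Matrix.mulVec, dotProduct, Matrix.updateRow_ne hu] using hx u

/-- If γ = 0, then β cof D = 0 forces β = 0, so some partite set P has size 2. Then γ = 2∏_{Q≠P}(n_Q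
- 2) gives a second set Q of size 2, and cof D vanishes after all. -/
theorem IsCompletePartite.gammaOf_ne_zero (h : IsCompletePartite K)
    (hc : cof (distMatrix K) ≠ 0) : gammaOf (parts K) ≠ 0 := by
  intro hγ
  have h1 := sum_adjugate_mul_eq h.sum_distMatrix_mul_numVec
  rw [h.sum_numVec, hγ, mul_zero] at h1
  have hβ : betaOf (parts K) = 0 := by
    rcases mul_eq_zero.1 h1.symm with h | h
    · exact h
    · exact absurd h hc
  rw [betaOf, hγ, zero_add, Finset.prod_eq_zero_iff] at hβ
  obtain ⟨P, hP, hP2⟩ := hβ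
  have hPc : (P.card : ℝ) = 2 := by linarith
  rw [gammaOf_eq_of_mem hP, hP2, zero_mul, add_zero, hPc] at hγ
  have h3 : ∏ Q ∈ (parts K).erase P, ((Q.card : ℝ) - 2) = 0 := by linarith
  obtain ⟨Q, hQ, hQ2⟩ := Finset.prod_eq_zero_iff.1 h3
  have hQc : (Q.card : ℝ) = 2 := by linarith
  obtain ⟨hQP, hQ⟩ := Finset.mem_erase.1 hQ
  have hcase : ∀ (f : Finset W → ℝ) (u : W),
      ∑ v ∈ part K u, f (part K v) = (part K u).card * f (part K u) := by
    intro f u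
    rw [Finset.sum_congr rfl (g := fun _ => f (part K u)), Finset.sum_const, nsmul_eq_mul]
    intro v hv
    rw [h.mem_part_iff.1 hv]
  -- The kernel vector 1_P - 1_Q: its total is 0, and on a set of size 2 the sum over the set
  -- cancels twice the own value.
  let f : Finset W → ℝ := fun R => if R = P then 1 else if R = Q then -1 else 0
  have hf : ∑ v, f (part K v) = 0 := by
    rw [h.sum_comp_part, ← Finset.add_sum_erase _ _ hP,
      ← Finset.add_sum_erase _ _ (Finset.mem_erase.2 ⟨hQP, hQ⟩), Finset.sum_eq_zero]
    · simp [f, hQP, hPc, hQc]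
    · intro R hR
      simp only [Finset.mem_erase] at hR
      simp [f, hR.1, hR.2.1]
  refine hc (cof_eq_zero_of_kernel (x := fun v => f (part K v)) ?_ ?_ hf)
  · obtain ⟨w, -, hw⟩ := Finset.mem_image.1 hP
    intro h0
    have := congrFun h0 w
    simp [f, hw] at this
  · intro u
    rw [h.sum_distMatrix_mul, hf, hcase]
    by_cases h1 : part K u = P
    · rw [h1, hPc]
      ring
    by_cases h2 : part K u = Q
    · rw [h2, hQc]
      ring
    simp [f, h1, h2]

theorem IsCompletePartite.sum_muSingle (h : IsCompletePartite K)
    (hγ : gammaOf (parts K) ≠ 0) : ∑ v, muSingle K v = 1 := by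
  simp_rw [muSingle_eq, ← Finset.mul_sum, h.sum_numVec]
  field_simp

theorem IsCompletePartite.sum_distMatrix_mul_muSingle (h : IsCompletePartite K)
    (hc : cof (distMatrix K) ≠ 0) (u : W) :
    ∑ v, distMatrix K u v * muSingle K v = (distMatrix K).det / cof (distMatrix K) := by
  have hγ := h.gammaOf_ne_zero hc
  have h1 := sum_adjugate_mul_eq h.sum_distMatrix_mul_numVec
  rw [h.sum_numVec] at h1
  have h2 : ∀ v, distMatrix K u v * muSingle K v
      = 1 / gammaOf (parts K) * (distMatrix K u v * numVec K v) := fun v => by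
    rw [muSingle_eq]
    ring
  rw [Finset.sum_congr rfl fun v _ => h2 v, ← Finset.mul_sum, h.sum_distMatrix_mul_numVec]
  field_simp
  linarith

/-- The nᵢ - 1 off-diagonal terms cancel the β part of the diagonal entry. The remaining -γ̂/γ is
balanced by the other partite sets in `sum_lapSingle`. -/
theorem IsCompletePartite.sum_part_lapSingle (h : IsCompletePartite K) (w : W) :
    ∑ v ∈ part K w, lapSingle K v w
      = - gammaOf ((parts K).erase (part K w)) / gammaOf (parts K) := by
  have hw : w ∈ part K w := h.mem_part_iff.2 rfl
  rw [← Finset.add_sum_erase _ _ hw, Finset.sum_congr rfl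
    (g := fun _ => - betaOf ((parts K).erase (part K w)) / (2 * gammaOf (parts K)))]
  · have hcard : (((part K w).erase w).card : ℝ) = (part K w).card - 1 := by
      rw [Finset.card_erase_of_mem hw, Nat.cast_sub (Finset.card_pos.2 ⟨w, hw⟩), Nat.cast_one]
    rw [Finset.sum_const, nsmul_eq_mul, hcard]
    simp only [lapSingle, Matrix.of_apply, if_true]
    ring
  · intro v hv
    obtain ⟨hvw, hv⟩ := Finset.mem_erase.1 hv
    have hp := h.mem_part_iff.1 hv
    simp [lapSingle, hvw, h.adj_iff, hp]

theorem IsCompletePartite.sum_other_part_lapSingle (h : IsCompletePartite K) (w : W)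
    {Q : Finset W} (hQ : Q ∈ (parts K).erase (part K w)) :
    ∑ v ∈ Q, lapSingle K v w = Q.card *
      (∏ P ∈ ((parts K).erase (part K w)).erase Q, ((P.card : ℝ) - 2)) / gammaOf (parts K) := by
  obtain ⟨hne, hQ⟩ := Finset.mem_erase.1 hQ
  rw [Finset.sum_congr rfl (g := fun _ =>
    (∏ P ∈ ((parts K).erase (part K w)).erase Q, ((P.card : ℝ) - 2)) / gammaOf (parts K)),
    Finset.sum_const, nsmul_eq_mul]
  · ring
  · intro v hv
    have hp := h.part_eq_of_mem_parts hQ hv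
    have hvw : v ≠ w := by
      rintro rfl
      exact hne hp.symm
    simp [lapSingle, hvw, h.adj_iff, hp, hne, Finset.erase_right_comm]

theorem IsCompletePartite.sum_lapSingle (h : IsCompletePartite K) (w : W) :
    ∑ v, lapSingle K v w = 0 := by
  rw [h.sum_eq_sum_parts, ← Finset.add_sum_erase _ _ (part_mem_parts K w), h.sum_part_lapSingle,
    Finset.sum_congr rfl fun Q hQ => h.sum_other_part_lapSingle w hQ, ← Finset.sum_div]
  rw [gammaOf]
  ring

theorem IsCompletePartite.sum_distMatrix_mul_lapSingle (h : IsCompletePartite K)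
    (hγ : gammaOf (parts K) ≠ 0) (u w : W) :
    ∑ v, distMatrix K u v * lapSingle K v w = muSingle K w - if u = w then 1 else 0 := by
  rw [h.sum_distMatrix_mul, h.sum_lapSingle, muSingle]
  by_cases hp : part K u = part K w
  · rw [hp, h.sum_part_lapSingle]
    by_cases huw : u = w
    · subst huw
      have h1 := gammaOf_eq_of_mem (part_mem_parts K u)
      simp only [lapSingle, Matrix.of_apply, if_true, betaOf]
      field_simp
      rw [h1]
      ring
    · simp only [lapSingle, Matrix.of_apply, huw, h.adj_iff, hp, betaOf, if_false, ne_eq,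
        not_true_eq_false]
      field_simp
      ring
  · have hmem : part K u ∈ (parts K).erase (part K w) :=
      Finset.mem_erase.2 ⟨hp, part_mem_parts K u⟩
    have huw : u ≠ w := by
      rintro rfl
      exact hp rfl
    rw [h.sum_other_part_lapSingle w hmem, ← Finset.mul_prod_erase _ _ hmem]
    simp only [lapSingle, Matrix.of_apply, huw, h.adj_iff, ne_eq, hp, if_false,
      not_false_eq_true, if_true, Finset.erase_right_comm (a := part K u)]
    field_simp
    ring

end CompleteMultipartite

end MultiBlock

namespace MultiBlock

/-! ### Blocks, ears and gates -/

section Blocks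

variable {V : Type*} {G : SimpleGraph V}

/-- A subgraph is nonseparable if it is nonempty, connected, and stays connected when any single
vertex is deleted. Connections are expressed by walks on the ambient vertex set. -/
def IsNonseparable (H : G.Subgraph) : Prop :=
  H.verts.Nonempty ∧ (∀ x ∈ H.verts, ∀ y ∈ H.verts, H.spanningCoe.Reachable x y) ∧
    ∀ v, ∀ x ∈ H.verts, ∀ y ∈ H.verts, x ≠ v → y ≠ v →
      (H.deleteVerts {v}).spanningCoe.Reachable x y

theorem reachable_coe_iff (H : G.Subgraph) (x y : H.verts) :
    H.coe.Reachable x y ↔ H.spanningCoe.Reachable (x : V) y := by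
  constructor
  · intro h
    exact h.map (⟨Subtype.val, fun h => h⟩ : H.coe →g H.spanningCoe)
  · obtain ⟨x, hx⟩ := x
    obtain ⟨y, hy⟩ := y
    rintro ⟨p⟩
    simp only at p
    induction p with
    | nil => exact .refl _
    | cons h p ih =>
      exact SimpleGraph.Reachable.trans
        (SimpleGraph.Adj.reachable (G := H.coe) (u := ⟨_, hx⟩) (v := ⟨_, H.edge_vert h.symm⟩) h)
        (ih _ hy)

theorem reachable_induce_compl_iff (H : G.Subgraph) (v : H.verts)
    (x y : ({v}ᶜ : Set H.verts)) :
    (H.coe.induce {v}ᶜ).Reachable x y ↔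
      (H.deleteVerts {(v : V)}).spanningCoe.Reachable (x : V) y := by
  have hne : ∀ z : ({v}ᶜ : Set H.verts), ((z : H.verts) : V) ≠ v := fun z hz =>
    z.2 (Subtype.ext hz)
  constructor
  · intro h
    refine h.map (⟨fun z => z.1.1, fun {a b} hab => ?_⟩ :
      H.coe.induce {v}ᶜ →g (H.deleteVerts {(v : V)}).spanningCoe)
    simpa [hne a, hne b] using hab
  · obtain ⟨⟨x, hx⟩, hxv⟩ := x
    obtain ⟨⟨y, hy⟩, hyv⟩ := y
    rintro ⟨p⟩
    simp only at p
    induction p with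
    | nil => exact .refl _
    | @cons a b c h p ih =>
      have h' : a ∈ H.verts ∧ a ≠ v ∧ b ∈ H.verts ∧ b ≠ v ∧ H.Adj a b := by
        simpa [and_assoc] using h
      obtain ⟨-, -, hb, hbv, hab⟩ := h'
      have hbv' : (⟨b, hb⟩ : H.verts) ∈ ({v}ᶜ : Set H.verts) := fun h => hbv (congrArg (·.1) h)
      exact SimpleGraph.Reachable.trans
        (SimpleGraph.Adj.reachable (G := H.coe.induce {v}ᶜ) (u := ⟨⟨a, hx⟩, hxv⟩)
          (v := ⟨⟨b, hb⟩, hbv'⟩) hab) (ih _ hbv' _ hyv)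

theorem spanningCoe_reachable_of_walk {H : G.Subgraph} {x y : V} (p : G.Walk x y)
    (hp : p.toSubgraph ≤ H) : H.spanningCoe.Reachable x y := by
  refine (p.transfer H.spanningCoe fun e he => ?_).reachable
  induction e with
  | _ a b => exact hp.2 (p.mem_edges_toSubgraph.2 he)

theorem deleteVerts_reachable_of_walk {H : G.Subgraph} {x y v : V} (p : G.Walk x y)
    (hp : p.toSubgraph ≤ H) (hv : v ∉ p.support) :
    (H.deleteVerts {v}).spanningCoe.Reachable x y := by
  refine spanningCoe_reachable_of_walk p ⟨fun a ha => ?_, fun a b hab => ?_⟩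
  · refine ⟨hp.1 ha, ?_⟩
    rintro rfl
    exact hv (p.mem_verts_toSubgraph.1 ha)
  · have hne : ∀ z ∈ p.toSubgraph.verts, z ≠ v := by
      rintro z hz h
      exact hv (h ▸ p.mem_verts_toSubgraph.1 hz)
    have hab' := hp.2 hab
    simp [hne a (p.toSubgraph.edge_vert hab), hne b (p.toSubgraph.edge_vert hab.symm), hab',
      H.edge_vert hab', H.edge_vert hab'.symm]

theorem spanningCoe_mono {H H' : G.Subgraph} (h : H ≤ H') : H.spanningCoe ≤ H'.spanningCoe :=
  fun _ _ hab => h.2 hab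

theorem connected_and_no_cutVertex_iff (H : G.Subgraph) :
    (H.coe.Connected ∧ ∀ v, ¬ IsCutVertex H.coe v) ↔ IsNonseparable H := by
  constructor
  · rintro ⟨hc, hcut⟩
    obtain ⟨z⟩ := hc.nonempty
    have hpre := hc.preconnected
    have hconn : ∀ x ∈ H.verts, ∀ y ∈ H.verts, H.spanningCoe.Reachable x y := fun x hx y hy =>
      (reachable_coe_iff H ⟨x, hx⟩ ⟨y, hy⟩).1 (hpre _ _)
    refine ⟨⟨z, z.2⟩, hconn, fun v x hx y hy hxv hyv => ?_⟩
    by_cases hv : v ∈ H.verts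
    · have h := not_not.1 (hcut ⟨v, hv⟩)
      exact (reachable_induce_compl_iff H ⟨v, hv⟩
        ⟨⟨x, hx⟩, fun h => hxv (congrArg (·.1) h)⟩ ⟨⟨y, hy⟩, fun h => hyv (congrArg (·.1) h)⟩).1
        (h _ _)
    -- `IsNonseparable` also allows v outside H, where the deletion changes nothing.
    · refine (hconn x hx y hy).mono fun a b hab => ?_
      have hne : ∀ z ∈ H.verts, z ≠ v := by
        rintro z hz rfl
        exact hv hz
      have hab' : H.Adj a b := hab
      simp [hab', H.edge_vert hab', H.edge_vert hab'.symm, hne _ (H.edge_vert hab'),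
        hne _ (H.edge_vert hab'.symm)]
  · rintro ⟨⟨z, hz⟩, hconn, hcut⟩
    have : Nonempty H.verts := ⟨⟨z, hz⟩⟩
    refine ⟨⟨fun x y => (reachable_coe_iff H x y).2 (hconn _ x.2 _ y.2)⟩, fun v => ?_⟩
    exact not_not.2 fun x y => (reachable_induce_compl_iff H v x y).2
      (hcut _ _ x.1.2 _ y.1.2 (fun h => x.2 (Subtype.ext h)) (fun h => y.2 (Subtype.ext h)))

theorem IsBlock.isNonseparable {H : G.Subgraph} (hH : IsBlock H) : IsNonseparable H :=
  (connected_and_no_cutVertex_iff H).1 hH.prop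

theorem IsBlock.le_of_isNonseparable {H H' : G.Subgraph} (hH : IsBlock H)
    (hH' : IsNonseparable H') (hle : H ≤ H') : H' ≤ H :=
  hH.le_of_ge ((connected_and_no_cutVertex_iff H').2 hH') hle

/-- Whichever vertex is deleted, one of s and t survives and links the two halves. -/
theorem IsNonseparable.sup {A B : G.Subgraph} (hA : IsNonseparable A) (hB : IsNonseparable B)
    {s t : V} (hst : s ≠ t) (hsA : s ∈ A.verts) (hsB : s ∈ B.verts) (htA : t ∈ A.verts)
    (htB : t ∈ B.verts) : IsNonseparable (A ⊔ B) := by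
  refine ⟨⟨s, Or.inl hsA⟩, ?_, fun v => ?_⟩
  · have key : ∀ x ∈ (A ⊔ B).verts, (A ⊔ B).spanningCoe.Reachable x s := by
      rintro x (hx | hx)
      · exact (hA.2.1 x hx s hsA).mono (spanningCoe_mono le_sup_left)
      · exact (hB.2.1 x hx s hsB).mono (spanningCoe_mono le_sup_right)
    exact fun x hx y hy => (key x hx).trans (key y hy).symm
  · obtain ⟨z, hzA, hzB, hzv⟩ : ∃ z, z ∈ A.verts ∧ z ∈ B.verts ∧ z ≠ v := by
      by_cases h : s = v
      · exact ⟨t, htA, htB, fun h' => hst (h.trans h'.symm)⟩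
      · exact ⟨s, hsA, hsB, h⟩
    have key : ∀ x ∈ (A ⊔ B).verts, x ≠ v →
        ((A ⊔ B).deleteVerts {v}).spanningCoe.Reachable x z := by
      rintro x (hx | hx) hxv
      · exact (hA.2.2 v x hx z hzA hxv hzv).mono
          (spanningCoe_mono (SimpleGraph.Subgraph.deleteVerts_mono le_sup_left))
      · exact (hB.2.2 v x hx z hzB hxv hzv).mono
          (spanningCoe_mono (SimpleGraph.Subgraph.deleteVerts_mono le_sup_right))
    exact fun x hx y hy hxv hyv => (key x hx hxv).trans (key y hy hyv).symm

theorem IsBlock.eq_of_mem_of_mem {A B : G.Subgraph} (hA : IsBlock A) (hB : IsBlock B)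
    {s t : V} (hst : s ≠ t) (hsA : s ∈ A.verts) (hsB : s ∈ B.verts) (htA : t ∈ A.verts)
    (htB : t ∈ B.verts) : A = B := by
  have h := hA.isNonseparable.sup hB.isNonseparable hst hsA hsB htA htB
  exact le_antisymm (le_sup_left.trans (hB.le_of_isNonseparable h le_sup_right))
    (le_sup_right.trans (hA.le_of_isNonseparable h le_sup_left))

theorem toSubgraph_takeUntil_le {x y z : V} (p : G.Walk x y) (hz : z ∈ p.support) :
    (p.takeUntil z hz).toSubgraph ≤ p.toSubgraph := by
  conv_rhs => rw [← p.take_spec hz]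
  rw [SimpleGraph.Walk.toSubgraph_append]
  exact le_sup_left

theorem toSubgraph_dropUntil_le {x y z : V} (p : G.Walk x y) (hz : z ∈ p.support) :
    (p.dropUntil z hz).toSubgraph ≤ p.toSubgraph := by
  conv_rhs => rw [← p.take_spec hz]
  rw [SimpleGraph.Walk.toSubgraph_append]
  exact le_sup_right

/-- A path visits v at most once, so v can lie on both sides of x only if v = x. -/
theorem notMem_support_take_or_drop {a b x v : V} {p : G.Walk a b} (hp : p.IsPath)
    (hx : x ∈ p.support) (hxv : x ≠ v) :
    v ∉ (p.takeUntil x hx).support ∨ v ∉ (p.dropUntil x hx).support := by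
  by_contra! h
  have hn := hp.support_nodup
  rw [← p.take_spec hx, SimpleGraph.Walk.support_append, List.nodup_append] at hn
  obtain ⟨h1, h2⟩ := h
  rw [SimpleGraph.Walk.mem_support_iff] at h2
  rcases h2 with h2 | h2
  · exact hxv h2.symm
  · exact hn.2.2 v h1 v h2 rfl

/-- Adding an ear to a nonseparable subgraph keeps it nonseparable. -/
theorem IsNonseparable.sup_toSubgraph {H : G.Subgraph} (hH : IsNonseparable H) {a b : V}
    (ha : a ∈ H.verts) (hb : b ∈ H.verts) {p : G.Walk a b} (hp : p.IsPath) :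
    IsNonseparable (H ⊔ p.toSubgraph) := by
  refine ⟨⟨a, Or.inl ha⟩, ?_, fun v => ?_⟩
  · have key : ∀ x ∈ (H ⊔ p.toSubgraph).verts,
        (H ⊔ p.toSubgraph).spanningCoe.Reachable x a := by
      rintro x (hx | hx)
      · exact (hH.2.1 x hx a ha).mono (spanningCoe_mono le_sup_left)
      · have hx' := p.mem_verts_toSubgraph.1 hx
        exact (spanningCoe_reachable_of_walk (p.takeUntil x hx')
          ((toSubgraph_takeUntil_le p hx').trans le_sup_right)).symm
    exact fun x hx y hy => (key x hx).trans (key y hy).symm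
  · have key : ∀ x ∈ (H ⊔ p.toSubgraph).verts, x ≠ v → ∃ z ∈ H.verts, z ≠ v ∧
        ((H ⊔ p.toSubgraph).deleteVerts {v}).spanningCoe.Reachable x z := by
      rintro x (hx | hx) hxv
      · exact ⟨x, hx, hxv, .refl _⟩
      · have hx' := p.mem_verts_toSubgraph.1 hx
        rcases notMem_support_take_or_drop hp hx' hxv with h | h
        · refine ⟨a, ha, ?_, (deleteVerts_reachable_of_walk (p.takeUntil x hx')
            ((toSubgraph_takeUntil_le p hx').trans le_sup_right) h).symm⟩
          rintro rfl
          exact h (SimpleGraph.Walk.start_mem_support _)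
        · refine ⟨b, hb, ?_, deleteVerts_reachable_of_walk (p.dropUntil x hx')
            ((toSubgraph_dropUntil_le p hx').trans le_sup_right) h⟩
          rintro rfl
          exact h (SimpleGraph.Walk.end_mem_support _)
    intro x hx y hy hxv hyv
    obtain ⟨x', hx', hxv', hxx⟩ := key x hx hxv
    obtain ⟨y', hy', hyv', hyy⟩ := key y hy hyv
    exact hxx.trans (((hH.2.2 v x' hx' y' hy' hxv' hyv').mono
      (spanningCoe_mono (SimpleGraph.Subgraph.deleteVerts_mono le_sup_left))).trans hyy.symm)

/-- A path between two vertices of a block lies in the block. -/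
theorem IsBlock.toSubgraph_le {H : G.Subgraph} (hH : IsBlock H) {a b : V}
    (ha : a ∈ H.verts) (hb : b ∈ H.verts) {p : G.Walk a b} (hp : p.IsPath) :
    p.toSubgraph ≤ H :=
  le_sup_right.trans (hH.le_of_isNonseparable
    (hH.isNonseparable.sup_toSubgraph ha hb hp) le_sup_left)

theorem isNonseparable_subgraphOfAdj {a b : V} (hab : G.Adj a b) :
    IsNonseparable (G.subgraphOfAdj hab) := by
  have h : (G.subgraphOfAdj hab).spanningCoe.Reachable a b :=
    SimpleGraph.Adj.reachable (by simp [hab.ne])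
  refine ⟨⟨a, by simp⟩, ?_, ?_⟩
  · rintro x (rfl | rfl) y (rfl | rfl)
    exacts [.refl _, h, h.symm, .refl _]
  · rintro v x (rfl | rfl) y (rfl | rfl) hx hy
    · exact .refl _
    · refine SimpleGraph.Adj.reachable ?_
      simp [hx, hy, hab.ne, hab.ne.symm]
    · refine SimpleGraph.Adj.reachable ?_
      simp [hx, hy, hab.ne, hab.ne.symm]
    · exact .refl _

theorem exists_isBlock_of_adj [Finite V] {a b : V} (hab : G.Adj a b) :
    ∃ H : G.Subgraph, IsBlock H ∧ a ∈ H.verts ∧ b ∈ H.verts := by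
  obtain ⟨H, hle, hH⟩ := (Set.toFinite {H : G.Subgraph | H.coe.Connected ∧
    ∀ v, ¬ IsCutVertex H.coe v}).exists_le_maximal
      ((connected_and_no_cutVertex_iff _).2 (isNonseparable_subgraphOfAdj hab))
  exact ⟨H, hH, hle.1 (by simp), hle.1 (by simp)⟩

/-- A walk into a set has an initial segment that meets the set in its end only. -/
theorem exists_append_first_mem {S : Set V} {u v : V} (p : G.Walk u v) (hv : v ∈ S) :
    ∃ (q : V) (p₁ : G.Walk u q) (p₂ : G.Walk q v), p = p₁.append p₂ ∧ q ∈ S ∧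
      ∀ x ∈ p₁.support, x ∈ S → x = q := by
  induction p with
  | nil => exact ⟨_, .nil, .nil, rfl, hv, by simp⟩
  | @cons a b c h p ih =>
    by_cases ha : a ∈ S
    · exact ⟨a, .nil, .cons h p, rfl, ha, by simp⟩
    · obtain ⟨q, p₁, p₂, hp, hq, hx⟩ := ih hv
      refine ⟨q, .cons h p₁, p₂, by rw [hp]; rfl, hq, fun x hxs hxS => ?_⟩
      rw [SimpleGraph.Walk.support_cons, List.mem_cons] at hxs
      rcases hxs with rfl | hxs
      · exact absurd hxS ha
      · exact hx x hxs hxS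

/-- Otherwise the two walks joined at u contain a path from a to b, which lies in H. Its first edge
ac comes from p, where c in H forces c = a, or from q, where a in H forces a = b. -/
theorem IsBlock.first_mem_unique {H : G.Subgraph} (hH : IsBlock H) {u a b : V}
    (ha : a ∈ H.verts) (hb : b ∈ H.verts) (p : G.Walk u a) (q : G.Walk u b)
    (hp : ∀ x ∈ p.support, x ∈ H.verts → x = a) (hq : ∀ x ∈ q.support, x ∈ H.verts → x = b) :
    a = b := by
  by_contra hab
  have hle := hH.toSubgraph_le ha hb (p.reverse.append q).bypass_isPath
  have hsub := (p.reverse.append q).edges_bypass_subset_edges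
  generalize (p.reverse.append q).bypass = r at hle hsub
  cases r with
  | nil => exact hab rfl
  | @cons _ c _ h r =>
    have hc : c ∈ H.verts := hle.1 (by simp)
    have he := hsub (a := s(a, c)) (by simp)
    rw [SimpleGraph.Walk.edges_append, List.mem_append, SimpleGraph.Walk.edges_reverse,
      List.mem_reverse] at he
    rcases he with he | he
    · exact h.ne (hp c (p.snd_mem_support_of_mem_edges he) hc).symm
    · exact hab (hq a (q.fst_mem_support_of_mem_edges he) ha)

/-- Every vertex has a gate in a block: a vertex of the block that lies on all walks from the given
vertex into the block. -/
theorem IsBlock.exists_gate (hG : G.Connected) {H : G.Subgraph} (hH : IsBlock H) (u : V) :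
    ∃ g ∈ H.verts, ∀ v ∈ H.verts, ∀ p : G.Walk u v, g ∈ p.support := by
  obtain ⟨z, hz⟩ := hH.isNonseparable.1
  obtain ⟨p⟩ := hG.preconnected u z
  obtain ⟨g, p₁, -, -, hg, hp₁⟩ := exists_append_first_mem p hz
  refine ⟨g, hg, fun v hv q => ?_⟩
  obtain ⟨g', q₁, q₂, rfl, hg', hq₁⟩ := exists_append_first_mem q hv
  rw [hH.first_mem_unique hg hg' p₁ q₁ hp₁ hq₁, SimpleGraph.Walk.mem_support_append_iff]
  exact Or.inl q₁.end_mem_support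

theorem dist_eq_add_of_mem_all_walks (hG : G.Connected) {u v g : V}
    (h : ∀ p : G.Walk u v, g ∈ p.support) : G.dist u v = G.dist u g + G.dist g v := by
  obtain ⟨p, hp⟩ := (hG.preconnected u v).exists_walk_length_eq_dist
  refine le_antisymm hG.dist_triangle ?_
  rw [← hp, ← congrArg SimpleGraph.Walk.length (p.take_spec (h p)),
    SimpleGraph.Walk.length_append]
  exact add_le_add (SimpleGraph.dist_le _) (SimpleGraph.dist_le _)

theorem exists_coe_walk {H : G.Subgraph} {a b : V} (p : G.Walk a b) (hp : p.toSubgraph ≤ H)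
    (ha : a ∈ H.verts) (hb : b ∈ H.verts) :
    ∃ q : H.coe.Walk ⟨a, ha⟩ ⟨b, hb⟩, q.length = p.length := by
  induction p with
  | nil => exact ⟨.nil, rfl⟩
  | @cons a c b h p ih =>
    rw [SimpleGraph.Walk.toSubgraph, sup_le_iff] at hp
    have hac : H.Adj a c := hp.1.2 (by simp)
    obtain ⟨q, hq⟩ := ih hp.2 (H.edge_vert hac.symm) hb
    exact ⟨.cons (show H.coe.Adj ⟨a, ha⟩ ⟨c, H.edge_vert hac.symm⟩ from hac) q, by simp [hq]⟩

/-- Blocks are isometric subgraphs. -/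
theorem IsBlock.dist_coe (hG : G.Connected) {H : G.Subgraph} (hH : IsBlock H) (a b : H.verts) :
    H.coe.dist a b = G.dist a b := by
  apply le_antisymm
  · obtain ⟨p, hp, hl⟩ := (hG.preconnected (a : V) b).exists_path_of_dist
    obtain ⟨q, hq⟩ := exists_coe_walk p (hH.toSubgraph_le a.2 b.2 hp) a.2 b.2
    rw [← hl, ← hq]
    exact SimpleGraph.dist_le q
  · obtain ⟨p, hp⟩ := (hH.prop.1.preconnected a b).exists_walk_length_eq_dist
    rw [← hp, ← p.length_map H.hom]
    exact SimpleGraph.dist_le _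

/-- The blocks containing `w` in which the gate of `u` is not `w` are the blocks that contain the
last edge of a given shortest path from `u` to `w`. -/
theorem IsBlock.gate_ne_iff (hG : G.Connected) {H : G.Subgraph} (hH : IsBlock H) {u x w g : V}
    (hxw : G.Adj x w) (hd : G.dist u w = G.dist u x + 1) (hw : w ∈ H.verts) (hg : g ∈ H.verts)
    (hgate : ∀ v ∈ H.verts, ∀ p : G.Walk u v, g ∈ p.support) : g ≠ w ↔ x ∈ H.verts := by
  constructor
  · intro hne
    obtain ⟨p, hp⟩ := (hG.preconnected u x).exists_walk_length_eq_dist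
    have hpath : (p.concat hxw).IsPath :=
      SimpleGraph.Walk.isPath_of_length_eq_dist _ (by simp [hp, hd])
    have hgp : g ∈ p.support := by
      have := hgate w hw (p.concat hxw)
      simpa [SimpleGraph.Walk.support_concat, hne] using this
    -- The piece from g to w joins two vertices of H, so it stays in H, and it passes through x.
    have hpath' : ((p.dropUntil g hgp).concat hxw).IsPath := by
      refine SimpleGraph.Walk.IsPath.of_append_right (p := p.takeUntil g hgp) ?_
      rwa [SimpleGraph.Walk.append_concat, p.take_spec]
    refine (hH.toSubgraph_le hg hw hpath').1 ?_
    rw [SimpleGraph.Walk.mem_verts_toSubgraph, SimpleGraph.Walk.support_concat]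
    simp
  · rintro hx rfl
    -- With gate w, the vertex x would be farther from u than w is.
    have h := dist_eq_add_of_mem_all_walks hG (hgate x hx)
    omega

end Blocks

end MultiBlock

namespace MultiBlock

/-! ### Gluing the blocks along gates -/

section Gluing

variable {V : Type*} [Fintype V] [DecidableEq V] {G : SimpleGraph V}

omit [DecidableEq V] in
theorem mem_blocks {H : G.Subgraph} : H ∈ blocks G ↔ IsBlock H := by
  simp [blocks]

/-- `g` assigns to every block `H` and vertex `u` the gate of `u` in `H`. -/
def IsGateMap (g : G.Subgraph → V → V) : Prop :=
  ∀ H, IsBlock H → ∀ u, g H u ∈ H.verts ∧ ∀ v ∈ H.verts, ∀ p : G.Walk u v, g H u ∈ p.support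

omit [Fintype V] [DecidableEq V] in
theorem exists_isGateMap (hG : G.Connected) : ∃ g : G.Subgraph → V → V, IsGateMap g := by
  have := hG.nonempty
  have h : ∀ (H : G.Subgraph) (u : V), ∃ g, IsBlock H →
      g ∈ H.verts ∧ ∀ v ∈ H.verts, ∀ p : G.Walk u v, g ∈ p.support := by
    intro H u
    by_cases hH : IsBlock H
    · obtain ⟨g, hg⟩ := hH.exists_gate hG u
      exact ⟨g, fun _ => hg⟩
    · exact ⟨u, fun h => absurd h hH⟩
  choose g hg using h
  exact ⟨g, fun H hH u => hg H u hH⟩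

omit [Fintype V] [DecidableEq V] in
theorem exists_adj_dist_eq (hG : G.Connected) {u w : V} (huw : u ≠ w) :
    ∃ x, G.Adj x w ∧ G.dist u w = G.dist u x + 1 := by
  -- Taken from w to u, so that the case split exposes the edge at w.
  obtain ⟨p, hp⟩ := (hG.preconnected w u).exists_walk_length_eq_dist
  cases p with
  | nil => exact absurd rfl huw
  | @cons _ x _ h p =>
    refine ⟨x, h.symm, le_antisymm ?_ ?_⟩
    · have := hG.dist_triangle (u := u) (v := x) (w := w)
      rwa [SimpleGraph.dist_eq_one_iff_adj.2 h.symm] at this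
    · rw [SimpleGraph.Walk.length_cons, SimpleGraph.dist_comm] at hp
      rw [← hp, SimpleGraph.dist_comm]
      exact Nat.add_le_add_right (SimpleGraph.dist_le p) 1

/-- The number of blocks in which `w` is the gate of `u`. -/
theorem IsGateMap.sum_eq (hG : G.Connected) {g : G.Subgraph → V → V} (hg : IsGateMap g)
    (u w : V) : ∑ H ∈ blocks G, (if g H u = w then (1 : ℝ) else 0) =
      (((blocks G).filter fun H => w ∈ H.verts).card : ℝ) - 1 + if u = w then 1 else 0 := by
  have hsub : ∀ H ∈ blocks G, (if g H u = w then (1 : ℝ) else 0) =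
      (if w ∈ H.verts then 1 else 0) - if w ∈ H.verts ∧ g H u ≠ w then 1 else 0 := by
    intro H hH
    by_cases h : g H u = w
    · have hw : w ∈ H.verts := h ▸ (hg H (mem_blocks.1 hH) u).1
      simp [h, hw]
    · by_cases hw : w ∈ H.verts <;> simp [h, hw]
  -- For u ≠ w the only such block is the one containing the edge xw; it is unique because two
  -- blocks share at most one vertex.
  have hone : ∑ H ∈ blocks G, (if w ∈ H.verts ∧ g H u ≠ w then (1 : ℝ) else 0) =
      1 - if u = w then 1 else 0 := by
    by_cases huw : u = w
    · subst huw
      rw [Finset.sum_eq_zero]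
      · simp
      · intro H hH
        refine if_neg fun h => h.2 ?_
        simpa using (hg H (mem_blocks.1 hH) u).2 u h.1 .nil
    · obtain ⟨x, hxw, hd⟩ := exists_adj_dist_eq hG huw
      obtain ⟨B, hB, hxB, hwB⟩ := exists_isBlock_of_adj hxw
      have hiff : ∀ H, IsBlock H → w ∈ H.verts → (g H u ≠ w ↔ x ∈ H.verts) := fun H hH hw =>
        hH.gate_ne_iff hG hxw hd hw (hg H hH u).1 (hg H hH u).2
      rw [Finset.sum_eq_single B]
      · rw [if_pos ⟨hwB, (hiff B hB hwB).2 hxB⟩, if_neg huw, sub_zero]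
      · intro H hH hne
        refine if_neg fun h => hne ?_
        have hH := mem_blocks.1 hH
        exact hH.eq_of_mem_of_mem hB hxw.ne ((hiff H hH h.1).1 h.2) hxB h.1 hwB
      · exact fun h => absurd (mem_blocks.2 hB) h
  rw [Finset.sum_congr rfl hsub, Finset.sum_sub_distrib, hone, Finset.card_filter]
  push_cast
  ring

/-- The vector `μ` of a block, extended by zero to all vertices of the graph. -/
noncomputable def muBlock (H : G.Subgraph) (v : V) : ℝ :=
  if h : v ∈ H.verts then muSingle H.coe ⟨v, h⟩ else 0

omit [DecidableEq V] in
theorem sum_mul_dite_mem (S : Set V) [Fintype S] (d : V → ℝ) (f : S → ℝ) :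
    ∑ v, d v * (if h : v ∈ S then f ⟨v, h⟩ else 0) = ∑ v : S, d v * f v := by
  have h := Finset.sum_subtype (p := (· ∈ S)) (F := ‹Fintype S›) (Finset.univ.filter (· ∈ S)) (by simp)
    (fun v => d v * (if h : v ∈ S then f ⟨v, h⟩ else 0))
  rw [Finset.sum_filter_of_ne] at h
  · rw [h]
    refine Finset.sum_congr rfl fun v _ => ?_
    rw [dif_pos v.2]
  · intro v _ hv
    by_contra h
    exact hv (by rw [dif_neg h, mul_zero])

omit [Fintype V] [DecidableEq V] in
theorem IsGateMap.distMatrix_eq (hG : G.Connected) {g : G.Subgraph → V → V} (hg : IsGateMap g)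
    {H : G.Subgraph} (hH : IsBlock H) (u : V) (v : H.verts) :
    distMatrix G u v = distMatrix G u (g H u) + distMatrix H.coe ⟨g H u, (hg H hH u).1⟩ v := by
  simp only [distMatrix, Matrix.of_apply]
  rw [hH.dist_coe hG, dist_eq_add_of_mem_all_walks hG ((hg H hH u).2 v v.2)]
  push_cast
  rfl

theorem sum_muBlock {H : G.Subgraph} (hK : IsCompletePartite H.coe)
    (hγ : gammaOf (parts H.coe) ≠ 0) : ∑ v, muBlock H v = 1 := by
  have h := sum_mul_dite_mem H.verts (fun _ => 1) (muSingle H.coe)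
  simp only [one_mul] at h
  exact h.trans (hK.sum_muSingle hγ)

theorem IsGateMap.sum_distMatrix_mul_muBlock (hG : G.Connected) {g : G.Subgraph → V → V}
    (hg : IsGateMap g) {H : G.Subgraph} (hH : IsBlock H) (hK : IsCompletePartite H.coe)
    (hc : cof (distMatrix H.coe) ≠ 0) (u : V) :
    ∑ v, distMatrix G u v * muBlock H v =
      distMatrix G u (g H u) + (distMatrix H.coe).det / cof (distMatrix H.coe) := by
  unfold muBlock
  rw [sum_mul_dite_mem H.verts (distMatrix G u) (muSingle H.coe),
    Finset.sum_congr rfl fun v _ => by rw [hg.distMatrix_eq hG hH u v, add_mul],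
    Finset.sum_add_distrib, ← Finset.mul_sum, hK.sum_muSingle (hK.gammaOf_ne_zero hc), mul_one,
    hK.sum_distMatrix_mul_muSingle hc]

theorem IsGateMap.sum_distMatrix_mul_lapBlock (hG : G.Connected) {g : G.Subgraph → V → V}
    (hg : IsGateMap g) {H : G.Subgraph} (hH : IsBlock H) (hK : IsCompletePartite H.coe)
    (hγ : gammaOf (parts H.coe) ≠ 0) (u w : V) :
    ∑ v, distMatrix G u v * lapBlock H v w =
      muBlock H w - if g H u = w then 1 else 0 := by
  by_cases hw : w ∈ H.verts
  · have h1 : ∀ v, lapBlock H v w =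
        if h : v ∈ H.verts then lapSingle H.coe ⟨v, h⟩ ⟨w, hw⟩ else 0 := by
      intro v
      by_cases h : v ∈ H.verts <;> simp [lapBlock, h, hw]
    rw [Finset.sum_congr rfl fun v _ => by rw [h1 v],
      sum_mul_dite_mem H.verts (distMatrix G u) fun v => lapSingle H.coe v ⟨w, hw⟩,
      Finset.sum_congr rfl fun v _ => by rw [hg.distMatrix_eq hG hH u v, add_mul],
      Finset.sum_add_distrib, ← Finset.mul_sum, hK.sum_lapSingle, mul_zero, zero_add,
      hK.sum_distMatrix_mul_lapSingle hγ, muBlock, dif_pos hw]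
    simp only [Subtype.mk.injEq]
  · have hne : g H u ≠ w := by
      rintro rfl
      exact hw (hg H hH u).1
    rw [muBlock, dif_neg hw, if_neg hne, sub_zero]
    refine Finset.sum_eq_zero fun v _ => ?_
    simp [lapBlock, hw]

/-- The base point u is free. Taking it to be the row index of D makes the gate distances D(u,g)
cancel in Dμ, leaving the sum of the block ratios det/cof. -/
theorem IsGateMap.muG_eq (hG : G.Connected) {g : G.Subgraph → V → V} (hg : IsGateMap g)
    (u v : V) : muG G v = ∑ H ∈ blocks G, (muBlock H v - if g H u = v then 1 else 0)
      + if u = v then 1 else 0 := by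
  rw [Finset.sum_sub_distrib, hg.sum_eq hG, muG]
  simp only [muBlock]
  ring

theorem IsMultiBlock.sum_muG (hG : IsMultiBlock G)
    (hγ : ∀ H ∈ blocks G, gammaOf (parts H.coe) ≠ 0) : ∑ v, muG G v = 1 := by
  obtain ⟨g, hg⟩ := exists_isGateMap hG.1
  obtain ⟨u⟩ := hG.1.nonempty
  simp_rw [hg.muG_eq hG.1 u]
  rw [Finset.sum_add_distrib, Finset.sum_comm, Finset.sum_eq_zero]
  · simp
  · intro H hH
    rw [Finset.sum_sub_distrib, sum_muBlock (hG.2 H hH) (hγ H hH)]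
    simp

theorem IsMultiBlock.sum_distMatrix_mul_muG (hG : IsMultiBlock G)
    (hc : ∀ H ∈ blocks G, cof (distMatrix H.coe) ≠ 0) (u : V) :
    ∑ v, distMatrix G u v * muG G v = lambdaG G := by
  obtain ⟨g, hg⟩ := exists_isGateMap hG.1
  rw [Finset.sum_congr rfl fun v _ => by rw [hg.muG_eq hG.1 u v, mul_add, Finset.mul_sum],
    Finset.sum_add_distrib, Finset.sum_comm, lambdaG]
  have h0 : ∑ v, distMatrix G u v * (if u = v then (1 : ℝ) else 0) = 0 := by
    simp [distMatrix]
  rw [h0, add_zero]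
  refine Finset.sum_congr rfl fun H hH => ?_
  simp only [mul_sub, Finset.sum_sub_distrib]
  rw [hg.sum_distMatrix_mul_muBlock hG.1 (mem_blocks.1 hH) (hG.2 H hH) (hc H hH)]
  simp

theorem IsMultiBlock.sum_distMatrix_mul_lapG (hG : IsMultiBlock G)
    (hγ : ∀ H ∈ blocks G, gammaOf (parts H.coe) ≠ 0) (u w : V) :
    ∑ v, distMatrix G u v * lapG G v w = muG G w - if u = w then 1 else 0 := by
  obtain ⟨g, hg⟩ := exists_isGateMap hG.1
  have h1 : ∀ v, lapG G v w = ∑ H ∈ blocks G, lapBlock H v w := fun v => by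
    rw [lapG, Matrix.sum_apply]
  rw [Finset.sum_congr rfl fun v _ => by rw [h1 v, Finset.mul_sum], Finset.sum_comm,
    hg.muG_eq hG.1 u w, add_sub_cancel_right]
  exact Finset.sum_congr rfl fun H hH =>
    hg.sum_distMatrix_mul_lapBlock hG.1 (mem_blocks.1 hH) (hG.2 H hH) (hγ H hH) u w

end Gluing

end MultiBlock

/-! ### The inverse -/

theorem mainTheorem1 {V : Type*} [Fintype V] [DecidableEq V] (G : SimpleGraph V)
    (hG : MultiBlock.IsMultiBlock G)
    (hcof : ∀ H ∈ MultiBlock.blocks G, MultiBlock.cof (MultiBlock.distMatrix H.coe) ≠ 0)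
    (hdet : (MultiBlock.distMatrix G).det ≠ 0) :
    (∀ H ∈ MultiBlock.blocks G, MultiBlock.gammaOf (MultiBlock.parts H.coe) ≠ 0) ∧
    MultiBlock.lambdaG G ≠ 0 ∧
    (MultiBlock.distMatrix G)⁻¹ =
      - MultiBlock.lapG G +
        (1 / MultiBlock.lambdaG G) • Matrix.vecMulVec (MultiBlock.muG G) (MultiBlock.muG G) := by
  have hγ : ∀ H ∈ MultiBlock.blocks G, MultiBlock.gammaOf (MultiBlock.parts H.coe) ≠ 0 :=
    fun H hH => (hG.2 H hH).gammaOf_ne_zero (hcof H hH)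
  have hμ := hG.sum_distMatrix_mul_muG hcof
  have hlam : MultiBlock.lambdaG G ≠ 0 := by
    intro h0
    refine hdet (Matrix.exists_mulVec_eq_zero_iff.1 ⟨MultiBlock.muG G, ?_, ?_⟩)
    · intro h
      have hs := hG.sum_muG hγ
      simp [h] at hs
    · ext u
      simpa [Matrix.mulVec, dotProduct, h0] using hμ u
  refine ⟨hγ, hlam, Matrix.inv_eq_right_inv ?_⟩
  ext u w
  have h1 : (MultiBlock.distMatrix G * MultiBlock.lapG G) u w =
      MultiBlock.muG G w - if u = w then 1 else 0 := by
    rw [Matrix.mul_apply]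
    exact hG.sum_distMatrix_mul_lapG hγ u w
  have h2 : (MultiBlock.distMatrix G * Matrix.vecMulVec (MultiBlock.muG G) (MultiBlock.muG G)) u w =
      MultiBlock.lambdaG G * MultiBlock.muG G w := by
    rw [Matrix.mul_apply, ← hμ u, Finset.sum_mul]
    exact Finset.sum_congr rfl fun v _ => by rw [Matrix.vecMulVec_apply, mul_assoc]
  rw [Matrix.mul_add, Matrix.mul_neg, Matrix.mul_smul, Matrix.add_apply, Matrix.neg_apply,
    Matrix.smul_apply, h1, h2, Matrix.one_apply, smul_eq_mul]
  field_simp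
  ring
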